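/- Let $\mathcal H$ be the complex upper half-plane and let $\eta(z)=q_z^{1/24}\prod_{n\ge 1}(1-q_z^n)$, with $q_z=e^{2\pi i z}$ and $q_z^{1/24}=e^{2\pi i z/24}$, be Dedekind's eta function. An $\eta$-quotient of level $N\ge 1$ is a function on $\mathcal H$ of the form $f(z)=\prod_{\delta\mid N}\eta(\delta z)^{r_\delta}$ with all $r_\delta\in\mathbb Z$. For $\gamma=\begin{pmatrix}a&b\\c&d\end{pmatrix}\in\mathrm{SL}_2(\mathbb Z)$ and $k\in\mathbb Z$ put $(f|_k\gamma)(z)=(cz+d)^{-k}f\left(\frac{az+b}{cz+d}\right)$. For a congruence subgroup $\Gamma\le \mathrm{SL}_2(\mathbb Z)$, let $M_k^!(\Gamma)$ be the space of functions $f:\mathcal H\to\mathbb C$ that are holomorphic on $\mathcal H$, satisfy $f|_k\gamma=f$ for all $\gamma\in\Gamma$, and are meromorphic at every cusp, i.e. for every $\gamma\in\mathrm{SL}_2(\mathbb Z)$ there are an integer $h\ge 1$, an integer $m$ and complex numbers $a_n$ $(n\ge m)$ with $(f|_k\gamma)(z)=\sum_{n\ge m}a_n e^{2\pi i n z/h}$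 for all $z\in\mathcal H$. **Theorem.** Let $p\ne q$ be primes with $p,q>3$, and let $N=pq$. If $k$ is a positive integer such that $$\gcd\left(\frac{p-1}{2},\frac{q-1}{2},\frac{pq-1}{2},12\right)\ \Big|\ k,$$ then $M_k^!(\Gamma_1(N))$ contains an $\eta$-quotient of level $N$. -/

import Mathlib

open scoped MatrixGroups ModularForm UpperHalfPlane Manifold

noncomputable section

/-- `g : ℍ → ℂ` is meromorphic at `i∞`: for some width `h ≥ 1` it is the sum on all of `ℍ` of a
Fourier expansion `∑ n, a n * q_h ^ n`, `q_h = exp (2 * π * I * τ / h)`, with `a n = 0` for all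
`n` below some bound `m`. (The width is needed since for `f` of level `Γ` the function `f ∣[k] γ`
is invariant only under those translations that lie in `γ⁻¹ Γ γ`.) -/
def MeromorphicAtImInfty (g : ℍ → ℂ) : Prop :=
  ∃ h : ℕ, 0 < h ∧ ∃ (m : ℤ) (a : ℤ → ℂ), (∀ n < m, a n = 0) ∧
    ∀ τ : ℍ, HasSum (fun n : ℤ => a n * Function.Periodic.qParam (h : ℝ) (τ : ℂ) ^ n) (g τ)

/-- Weakly modular functions of weight `k` and level `Γ ≤ SL(2, ℤ)`: holomorphic on `ℍ`,
invariant under the weight `k` slash action of `Γ`, and meromorphic at every cusp; the cusps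
are the points `γ • i∞` with `γ ∈ SL(2, ℤ)`, and meromorphy there is that of `f ∣[k] γ` at `i∞`. -/
structure IsWeaklyModular (Γ : Subgroup SL(2, ℤ)) (k : ℤ) (f : ℍ → ℂ) : Prop where
  holomorphic : MDifferentiable 𝓘(ℂ) 𝓘(ℂ) f
  slash_eq : ∀ γ ∈ Γ, f ∣[k] γ = f
  meromorphic_at_cusps : ∀ γ : SL(2, ℤ), MeromorphicAtImInfty (f ∣[k] γ)

/-- The space `M_k^!(Γ)` of weakly modular functions of weight `k` and level `Γ`. -/
def weaklyModularForms (k : ℤ) (Γ : Subgroup SL(2, ℤ)) : Set (ℍ → ℂ) :=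
  {f | IsWeaklyModular Γ k f}

/-- The function `τ ↦ ∏_{δ ∣ N} η (δ τ) ^ r_δ`. -/
def etaQuotient (N : ℕ) (r : ℕ → ℤ) (τ : ℍ) : ℂ :=
  ∏ δ ∈ N.divisors, ModularForm.eta ((δ : ℂ) * (τ : ℂ)) ^ r δ

/-- `f` is an `η`-quotient of level `N`. -/
def IsEtaQuotient (N : ℕ) (f : ℍ → ℂ) : Prop :=
  ∃ r : ℕ → ℤ, f = etaQuotient N r

end

/-! For `N` prime to 6, `∏ η(δz)^{r_δ}` has level Γ₁(N) and weight k once `Σ r_δ = 2k` and `24 ∣ Σ δ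
r_δ`. The usual companion `24 ∣ Σ (N/δ) r_δ` comes for free: `δ² ≡ 1 (mod 24)` gives `N/δ ≡ Nδ`. For
`N = pq` a Bézout relation for the given gcd solves both conditions (`exists_exponents`).

Invariance rests on the explicit multiplier of η for odd `c > 0` (`eta_smul_of_odd`), obtained by
Euclidean descent on `c` with quadratic reciprocity. On Γ₁(N) the multiplier of `η(δz)` is a factor
independent of δ times `ζ^(Eδ)`, so the two sums of exponents settle everything. As `N` is odd,
multiplying by `(1, 0; N, 1)` reduces even `c` to odd `c`.

At a cusp, `diag(δ, 1) γ = γ' (A, B; 0, D)` with `γ'` unimodular turns `η(δ γz)` into `η((Az +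
B)/D)`: a power of the local parameter times a zero-free holomorphic function on the disc. -/

/-- The primitive 24th root of unity `exp (2πi / 24)`. -/
noncomputable def zeta24 : ℂ := Complex.exp (2 * Real.pi * Complex.I / 24)

namespace EtaQuotient

open Complex hiding eta
open ModularForm

/-! ### Powers of ζ₂₄, branches of the square root, generators acting on η -/

lemma zeta24_ne_zero : zeta24 ≠ 0 := exp_ne_zero _

lemma zeta24_zpow (n : ℤ) : zeta24 ^ n = exp (2 * Real.pi * I * n / 24) := by
  rw [zeta24, ← exp_int_mul]; ring_nf

lemma zeta24_pow_24 : zeta24 ^ (24 : ℤ) = 1 := by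
  rw [zeta24_zpow, ← exp_two_pi_mul_I]; push_cast; ring_nf

lemma zeta24_pow_12 : zeta24 ^ (12 : ℤ) = -1 := by
  rw [zeta24_zpow, ← exp_pi_mul_I]; push_cast; ring_nf

lemma zeta24_zpow_eq_of_dvd {m n : ℤ} (h : (24 : ℤ) ∣ m - n) : zeta24 ^ m = zeta24 ^ n := by
  obtain ⟨t, ht⟩ := h
  rw [show m = n + 24 * t by lia, zpow_add₀ zeta24_ne_zero, zpow_mul, zeta24_pow_24]
  simp

lemma sqrt_I_eq : sqrt I = zeta24 ^ (3 : ℤ) := by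
  rw [sqrt, cpow_def_of_ne_zero I_ne_zero, log_I, zeta24_zpow]
  push_cast; ring_nf

lemma sqrt_neg_I_eq : sqrt (-I) = zeta24 ^ (-3 : ℤ) := by
  rw [sqrt, cpow_def_of_ne_zero (by simp), log_neg_I, zeta24_zpow]
  push_cast; ring_nf

/-- The principal root is multiplicative as long as the arguments add without crossing the cut. All
later uses involve `-I * (c * z + d)`, which lies in the right half-plane for `c > 0`. -/
lemma sqrt_mul_of_arg {x y : ℂ} (hx : x ≠ 0) (hy : y ≠ 0)
    (h : arg x + arg y ∈ Set.Ioc (-Real.pi) Real.pi) : sqrt (x * y) = sqrt x * sqrt y := by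
  rw [sqrt, sqrt, sqrt, cpow_def_of_ne_zero hx, cpow_def_of_ne_zero hy,
    cpow_def_of_ne_zero (mul_ne_zero hx hy), log_mul hx hy h, ← exp_add]
  ring_nf

lemma sqrt_mul_of_re_pos {x y : ℂ} (hx : 0 < x.re) (hy : 0 < y.re) :
    sqrt (x * y) = sqrt x * sqrt y := by
  have h1 := abs_lt.mp (abs_arg_lt_pi_div_two_iff.mpr (.inl hx))
  have h2 := abs_lt.mp (abs_arg_lt_pi_div_two_iff.mpr (.inl hy))
  refine sqrt_mul_of_arg (by rintro rfl; simp at hx) (by rintro rfl; simp at hy) ⟨?_, ?_⟩ <;>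
  linarith

lemma sqrt_I_mul {w : ℂ} (hw : 0 < w.re) : sqrt (I * w) = zeta24 ^ (3 : ℤ) * sqrt w := by
  have h1 := abs_lt.mp (abs_arg_lt_pi_div_two_iff.mpr (.inl hw))
  rw [sqrt_mul_of_arg I_ne_zero (by rintro rfl; simp at hw), sqrt_I_eq]
  rw [arg_I]
  constructor <;> linarith [Real.pi_pos]

lemma sqrt_neg_I_mul {w : ℂ} (hw : 0 < w.re) : sqrt (-I * w) = zeta24 ^ (-3 : ℤ) * sqrt w := by
  have h1 := abs_lt.mp (abs_arg_lt_pi_div_two_iff.mpr (.inl hw))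
  rw [sqrt_mul_of_arg (by simp) (by rintro rfl; simp at hw), sqrt_neg_I_eq]
  rw [arg_neg_I]
  constructor <;> linarith [Real.pi_pos]

lemma sqrt_sq (z : ℂ) : sqrt z ^ 2 = z := by
  rw [sqrt, ← cpow_nat_mul]; norm_num

lemma eta_add_int (z : ℂ) (m : ℤ) : eta (z + m) = zeta24 ^ m * eta z := by
  have h1 : Function.Periodic.qParam 24 (z + m) = zeta24 ^ m * Function.Periodic.qParam 24 z := by
    rw [Function.Periodic.qParam, Function.Periodic.qParam, zeta24_zpow, ← exp_add]
    push_cast; ring_nf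
  have h2 : Function.Periodic.qParam 1 (z + m) = Function.Periodic.qParam 1 z := by
    rw [Function.Periodic.qParam, Function.Periodic.qParam, exp_eq_exp_iff_exists_int]
    exact ⟨m, by push_cast; ring⟩
  simp only [eta, eta_q, h1, h2, mul_assoc]

lemma eta_neg_one_div {z : ℂ} (hz : 0 < z.im) : eta (-1 / z) = sqrt (-I * z) * eta z := by
  have h := eta_comp_eq_csqrt_I_inv hz
  simp only [Function.comp, Pi.smul_apply, Pi.mul_apply, smul_eq_mul] at h
  rw [h, ← mul_assoc]
  congr 1
  have h2 : z = I * (-I * z) := by rw [← mul_assoc]; simp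
  have h3 := sqrt_I_mul (w := -I * z) (by simpa using hz)
  rw [← h2] at h3
  rw [h3, sqrt_I_eq, inv_mul_cancel_left₀ (zpow_ne_zero _ zeta24_ne_zero)]

/-! ### The multiplier of η for odd lower left entry -/

/-- The exponent of the multiplier of `η` at a matrix with odd positive lower left entry. -/
def etaExp (a b c d : ℤ) : ℤ := (a + d) * c - b * d * (c ^ 2 - 1) - 3 * c + 3

lemma dvd_sq_sub_one_of_odd {c : ℤ} (hc : Odd c) : (8 : ℤ) ∣ c ^ 2 - 1 := by
  obtain ⟨k, rfl⟩ := hc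
  obtain ⟨t, ht⟩ := (Int.even_mul_succ_self k)
  exact ⟨t, by linear_combination 4 * ht⟩

/-- Compatibility with `η(z + m) = ζ^m η(z)`. The difference is `c² - 1` times a second factor; 8
divides `c² - 1`, and 3 divides `c² - 1` or, when `3 ∣ c`, the second factor by the determinant
relation. -/
lemma dvd_etaExp_sub {a b c d : ℤ} (hc : Odd c) (h : a * d - b * c = 1) (m : ℤ) :
    (24 : ℤ) ∣ etaExp a (b + m * a) c (d + m * c) - (etaExp a b c d + m) := by
  have h8 : (8 : ℤ) ∣ etaExp a (b + m * a) c (d + m * c) - (etaExp a b c d + m) := by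
    obtain ⟨t, ht⟩ := dvd_sq_sub_one_of_odd hc
    refine ⟨t * (m - m * (b * c + a * d) - m ^ 2 * a * c), ?_⟩
    rw [etaExp, etaExp]
    linear_combination (m - m * (b * c + a * d) - m ^ 2 * a * c) * ht
  have h3 : (3 : ℤ) ∣ etaExp a (b + m * a) c (d + m * c) - (etaExp a b c d + m) := by
    have key : etaExp a (b + m * a) c (d + m * c) - (etaExp a b c d + m)
        = (c ^ 2 - 1) * (m - m * (b * c + a * d) - m ^ 2 * a * c) := by
      rw [etaExp, etaExp]; ring
    rw [key]
    have h4 : a * d = 1 + b * c := by linarith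
    rcases (by lia : c % 3 = 0 ∨ c % 3 = 1 ∨ c % 3 = 2) with h5 | h5 | h5
    · obtain ⟨t, rfl⟩ := Int.dvd_of_emod_eq_zero h5
      rw [h4]
      refine Dvd.dvd.mul_left ⟨-2 * m * b * t - m ^ 2 * a * t, by ring⟩ _
    · obtain ⟨t, ht⟩ : ∃ t, c = 3 * t + 1 := ⟨c / 3, by lia⟩
      exact Dvd.dvd.mul_right ⟨3 * t ^ 2 + 2 * t, by rw [ht]; ring⟩ _
    · obtain ⟨t, ht⟩ : ∃ t, c = 3 * t + 2 := ⟨c / 3, by lia⟩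
      exact Dvd.dvd.mul_right ⟨3 * t ^ 2 + 4 * t + 1, by rw [ht]; ring⟩ _
  lia

lemma jacobiSym_neg_of_odd {c d : ℕ} (hc : Odd c) (hd : Odd d) :
    (jacobiSym (-c) d : ℂ) =
      zeta24 ^ (3 * ((c : ℤ) + 1) * (d - 1)) * jacobiSym d c := by
  obtain ⟨u, rfl⟩ := hc
  obtain ⟨v, rfl⟩ := hd
  rw [jacobiSym.neg _ ⟨v, rfl⟩, ZMod.χ₄_eq_neg_one_pow (by lia),
    jacobiSym.quadratic_reciprocity ⟨u, rfl⟩ ⟨v, rfl⟩]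
  rw [show (3 * (((2 * u + 1 : ℕ) : ℤ) + 1) * ((2 * v + 1 : ℕ) - 1)) =
    (12 : ℤ) * (v + u * v : ℕ) by push_cast; ring, zpow_mul, zeta24_pow_12, zpow_natCast,
    show (2 * u + 1) / 2 = u by lia, show (2 * v + 1) / 2 = v by lia, pow_add]
  push_cast
  ring

lemma jacobiSym_of_odd_neg {c d : ℕ} (hc : Odd c) (hd : Odd d) :
    (jacobiSym c d : ℂ) =
      zeta24 ^ (3 * ((c : ℤ) - 1) * (d + 1)) * jacobiSym (-d) c := by
  rw [jacobiSym_neg_of_odd hd hc, ← mul_assoc, ← zpow_add₀ zeta24_ne_zero,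
    zeta24_zpow_eq_of_dvd (n := 0)]
  · simp
  · obtain ⟨u, rfl⟩ := hc
    obtain ⟨v, rfl⟩ := hd
    exact ⟨u * (v + 1), by push_cast; ring⟩

/-- The transformation law of `η` under a matrix with odd positive lower left entry. -/
theorem eta_smul_of_odd (c : ℕ) (hc : Odd c) (a b d : ℤ) (h : a * d - b * c = 1) (z : ℂ)
    (hz : 0 < z.im) :
    eta ((a * z + b) / (c * z + d)) =
      jacobiSym d c * zeta24 ^ etaExp a b c d * sqrt (-I * (c * z + d)) * eta z := by
  induction c using Nat.strong_induction_on generalizing a b d z with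
  | _ c ih =>
  have hc0 : 0 < c := hc.pos
  -- it suffices to treat one representative of `d` modulo `c`
  have shift : ∀ m : ℤ, (∀ z : ℂ, 0 < z.im →
      eta ((a * z + (b + m * a : ℤ)) / (c * z + (d + m * c : ℤ))) =
      jacobiSym (d + m * c) c * zeta24 ^ etaExp a (b + m * a) c (d + m * c) *
        sqrt (-I * (c * z + (d + m * c : ℤ))) * eta z) →
      eta ((a * z + b) / (c * z + d)) =
      jacobiSym d c * zeta24 ^ etaExp a b c d * sqrt (-I * (c * z + d)) * eta z := by
    intro m hm
    have h1 := hm (z + (-m : ℤ)) (by simpa using hz)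
    rw [eta_add_int, zeta24_zpow_eq_of_dvd (dvd_etaExp_sub (mod_cast hc) h m),
      zpow_add₀ zeta24_ne_zero, jacobiSym.mod_left' (a₂ := d) (by simp)] at h1
    rw [show (a * z + b : ℂ) = a * (z + (-m : ℤ)) + (b + m * a : ℤ) by push_cast; ring,
      show (c * z + d : ℂ) = c * (z + (-m : ℤ)) + (d + m * c : ℤ) by push_cast; ring, h1]
    rw [zpow_neg]
    have := zpow_ne_zero m zeta24_ne_zero
    field_simp
  by_cases hc1 : c = 1
  · subst hc1
    apply shift (-d)
    intro z hz
    have hz0 : z ≠ 0 := by rintro rfl; simp at hz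
    have hb : b + -d * a = -1 := by push_cast at h; linarith
    rw [hb]
    simp only [Nat.cast_one, mul_one, add_neg_cancel, jacobiSym.one_right, one_mul]
    rw [show (a * z + (-1 : ℤ) : ℂ) / (z + (0 : ℤ)) = -1 / z + a by
      push_cast; rw [add_zero, eq_comm]; field_simp; ring,
      eta_add_int, eta_neg_one_div hz]
    simp [etaExp]
    ring
  · have hcop : IsCoprime d (c : ℤ) := ⟨a, -b, by linear_combination h⟩
    have hmod0 : d % c ≠ 0 := by
      intro h0
      have := (Int.isCoprime_iff_gcd_eq_one.mp hcop)
      have h2 := Int.dvd_coe_gcd (Int.dvd_of_emod_eq_zero h0) (dvd_refl (c : ℤ))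
      rw [this] at h2
      have := Int.le_of_dvd (by simp) h2
      lia
    have hmp := Int.emod_nonneg d (b := c) (by lia)
    have hml := Int.emod_lt_of_pos d (b := c) (by lia)
    have hdiv := Int.emod_add_mul_ediv d c
    -- Descent needs an odd new lower left entry. Since `c` is odd, one of the residues `d % c` and
    -- `d % c - c` is odd, and both are below `c` in absolute value because `d % c ≠ 0`.
    obtain ⟨m, hm⟩ : ∃ m : ℤ, Odd (d + m * c) ∧ |d + m * c| < c := by
      rcases Int.even_or_odd (d % c) with he | ho
      · refine ⟨-(d / c) - 1, ?_, ?_⟩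
        · rw [show d + (-(d / c) - 1) * c = d % c - c by linear_combination -hdiv]
          exact he.sub_odd (mod_cast hc)
        · rw [show d + (-(d / c) - 1) * c = d % c - c by linear_combination -hdiv]
          rw [abs_lt]; lia
      · refine ⟨-(d / c), ?_, ?_⟩
        · rwa [show d + (-(d / c)) * c = d % c by linear_combination -hdiv]
        · rw [show d + (-(d / c)) * c = d % c by linear_combination -hdiv]
          rw [abs_lt]; lia
    apply shift m
    have hdet : a * (d + m * c) - (b + m * a) * c = 1 := by linear_combination h
    generalize d + m * c = d' at *
    generalize b + m * a = b' at *
    clear shift hdiv hml hmp hmod0 hcop h hz z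
    intro z hz
    have hz0 : z ≠ 0 := by rintro rfl; simp at hz
    have hSz : 0 < (-1 / z).im := by
      rw [neg_div, one_div, neg_im, inv_im]
      have := normSq_pos.mpr hz0
      rw [← neg_div, neg_neg]
      positivity
    have hW : 0 < (-I * (c * z + d')).re := by
      simpa using mul_pos (Nat.cast_pos.mpr hc0) hz
    have hY : 0 < (-I * z).re := by simpa using hz
    obtain ⟨hodd, hlt⟩ := hm
    -- Replacing `z` by `-1/z` makes `|d'| < c` the lower left entry; the sign of `d'` decides the
    -- branch of the root and the form of reciprocity.
    rcases lt_trichotomy d' 0 with hd | rfl | hd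
    · obtain ⟨e, rfl⟩ : ∃ e : ℕ, d' = -e := ⟨d'.natAbs, by lia⟩
      have he : Odd e := by
        exact_mod_cast (odd_neg.mp hodd)
      have he0 : 0 < e := by lia
      have hX : 0 < (-I * (e * (-1 / z) + c)).re := by
        simpa using mul_pos (Nat.cast_pos.mpr he0) hSz
      have key := ih e (by rw [abs_lt] at hlt; lia) he (-b') a c (by linear_combination hdet) (-1 / z) hSz
      rw [eta_neg_one_div hz, Int.cast_natCast] at key
      have e1 : (((-b' : ℤ) : ℂ) * (-1 / z) + a) / (e * (-1 / z) + c) =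
          (a * z + b') / (c * z + (-e : ℤ)) := by
        rw [show ((-b' : ℤ) : ℂ) * (-1 / z) + a = (a * z + b') / z by
          push_cast; field_simp; ring]
        rw [show (e * (-1 / z) + c : ℂ) = (c * z + (-e : ℤ)) / z by
          push_cast; field_simp; ring]
        rw [div_div_div_cancel_right₀ hz0]
      have e2 : sqrt (-I * (e * (-1 / z) + c)) * sqrt (-I * z) =
          zeta24 ^ (-3 : ℤ) * sqrt (-I * (c * z + (-e : ℤ))) := by
        rw [← sqrt_mul_of_re_pos hX hY, ← sqrt_neg_I_mul hW]
        congr 1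
        push_cast
        field_simp
        ring
      have e3 : (jacobiSym c e : ℂ) * zeta24 ^ etaExp (-b') a e c * zeta24 ^ (-3 : ℤ) =
          jacobiSym (-e) c * zeta24 ^ etaExp a b' c (-e) := by
        rw [jacobiSym_of_odd_neg hc he]
        rw [mul_comm (zeta24 ^ (_ : ℤ)) (_ : ℂ), mul_assoc, mul_assoc,
          ← zpow_add₀ zeta24_ne_zero, ← zpow_add₀ zeta24_ne_zero]
        congr 1
        apply zeta24_zpow_eq_of_dvd
        obtain ⟨u, rfl⟩ := hc
        obtain ⟨v, rfl⟩ := he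
        -- By the determinant relation the exponents differ by `6(c - 1)(e + 1)`.
        refine ⟨u * (v + 1), ?_⟩
        simp only [etaExp]
        push_cast at hdet ⊢
        linear_combination ((2 * u + 1) * (2 * v + 1) : ℤ) * hdet
      rw [← e1, key]
      linear_combination (jacobiSym c e * zeta24 ^ etaExp (-b') a e c * eta z) * e2 +
        (sqrt (-I * (c * z + (-e : ℤ))) * eta z) * e3
    · simp at hodd
    · obtain ⟨e, rfl⟩ : ∃ e : ℕ, d' = e := ⟨d'.natAbs, by lia⟩
      have he : Odd e := by exact_mod_cast hodd
      have he0 : 0 < e := by lia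
      have hX : 0 < (-I * (e * (-1 / z) + (-c : ℤ))).re := by
        simpa using mul_pos (Nat.cast_pos.mpr he0) hSz
      have key := ih e (by rw [abs_lt] at hlt; lia) he b' (-a) (-c) (by linear_combination hdet) (-1 / z) hSz
      rw [eta_neg_one_div hz] at key
      have e1 : ((b' : ℂ) * (-1 / z) + (-a : ℤ)) / (e * (-1 / z) + (-c : ℤ)) =
          (a * z + b') / (c * z + (e : ℤ)) := by
        rw [show (b' : ℂ) * (-1 / z) + (-a : ℤ) = -(a * z + b') / z by
          push_cast; field_simp; ring]
        rw [show (e * (-1 / z) + (-c : ℤ) : ℂ) = -(c * z + (e : ℤ)) / z by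
          push_cast; field_simp; ring]
        rw [div_div_div_cancel_right₀ hz0, neg_div_neg_eq]
      have e2 : sqrt (-I * (e * (-1 / z) + (-c : ℤ))) * sqrt (-I * z) =
          zeta24 ^ (3 : ℤ) * sqrt (-I * (c * z + (e : ℤ))) := by
        rw [← sqrt_mul_of_re_pos hX hY, ← sqrt_I_mul hW]
        congr 1
        push_cast
        field_simp
        ring
      have e3 : (jacobiSym (-c) e : ℂ) * zeta24 ^ etaExp b' (-a) e (-c) * zeta24 ^ (3 : ℤ) =
          jacobiSym e c * zeta24 ^ etaExp a b' c e := by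
        rw [jacobiSym_neg_of_odd hc he]
        rw [mul_comm (zeta24 ^ (_ : ℤ)) (_ : ℂ), mul_assoc, mul_assoc,
          ← zpow_add₀ zeta24_ne_zero, ← zpow_add₀ zeta24_ne_zero]
        congr 1
        apply zeta24_zpow_eq_of_dvd
        obtain ⟨u, rfl⟩ := hc
        obtain ⟨v, rfl⟩ := he
        -- The witness is zero: the determinant relation makes the exponents equal.
        refine ⟨u * v - u * v, ?_⟩
        simp only [etaExp]
        push_cast at hdet ⊢
        linear_combination (-(2 * u + 1) * (2 * v + 1) : ℤ) * hdet
      rw [← e1, key]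
      linear_combination (jacobiSym (-c) e * zeta24 ^ etaExp b' (-a) e (-c) * eta z) * e2 +
        (sqrt (-I * (c * z + (e : ℤ))) * eta z) * e3

lemma prod_zpow_eq_zpow_sum {ι : Type*} (s : Finset ι) (r : ι → ℤ) {x : ℂ} (hx : x ≠ 0) :
    ∏ i ∈ s, x ^ r i = x ^ ∑ i ∈ s, r i := by
  classical
  induction s using Finset.induction_on with
  | empty => simp
  | insert i t hi ih => rw [Finset.prod_insert hi, Finset.sum_insert hi, zpow_add₀ hx, ih]

lemma sl2_det (γ : SL(2, ℤ)) : γ 0 0 * γ 1 1 - γ 0 1 * γ 1 0 = 1 := by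
  rw [← Matrix.det_fin_two, γ.det_coe]

lemma coe_sl2_smul (γ : SL(2, ℤ)) (τ : ℍ) :
    ((γ • τ : ℍ) : ℂ) = (γ 0 0 * τ + γ 0 1) / (γ 1 0 * τ + γ 1 1) := by
  rw [UpperHalfPlane.coe_specialLinearGroup_apply]
  simp

lemma sl2_slash_apply (k : ℤ) (f : ℍ → ℂ) (γ : SL(2, ℤ)) (τ : ℍ) :
    (f ∣[k] γ) τ = f (γ • τ) * (γ 1 0 * τ + γ 1 1 : ℂ) ^ (-k) := by
  rw [SL_slash_apply, ← ModularGroup.denom_apply]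

lemma sl2_denom_ne_zero (γ : SL(2, ℤ)) (τ : ℍ) : (γ 1 0 * τ + γ 1 1 : ℂ) ≠ 0 := by
  rw [← ModularGroup.denom_apply]
  exact UpperHalfPlane.denom_ne_zero _ _

lemma sqrt_zpow_two_mul (z : ℂ) (k : ℤ) : sqrt z ^ (2 * k) = z ^ k := by
  rw [zpow_mul]
  congr 1
  exact_mod_cast sqrt_sq z

lemma dvd_sq_sub_one_of_coprime {n : ℕ} (h : n.Coprime 6) : (24 : ℤ) ∣ (n : ℤ) ^ 2 - 1 := by
  have h2 : n % 2 = 1 := by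
    have : n.Coprime 2 := h.coprime_dvd_right (by norm_num)
    rwa [Nat.coprime_two_right, Nat.odd_iff] at this
  have h3 : n % 3 ≠ 0 := by
    have : n.Coprime 3 := h.coprime_dvd_right (by norm_num)
    intro h0
    have := Nat.Coprime.eq_one_of_dvd this.symm (Nat.dvd_of_mod_eq_zero h0)
    lia
  have h8 := dvd_sq_sub_one_of_odd (c := n) (mod_cast Nat.odd_iff.mpr h2)
  have h9 : (3 : ℤ) ∣ (n : ℤ) ^ 2 - 1 := by
    rcases (by lia : n % 3 = 1 ∨ n % 3 = 2) with h5 | h5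
    · obtain ⟨t, ht⟩ : ∃ t, n = 3 * t + 1 := ⟨n / 3, by lia⟩
      exact ⟨3 * t ^ 2 + 2 * t, by rw [ht]; push_cast; ring⟩
    · obtain ⟨t, ht⟩ : ∃ t, n = 3 * t + 2 := ⟨n / 3, by lia⟩
      exact ⟨3 * t ^ 2 + 4 * t + 1, by rw [ht]; push_cast; ring⟩
  lia

/-! ### Invariance under Γ₁(N) -/

section Invariance

variable {N : ℕ} {r : ℕ → ℤ} {k : ℤ}

/-- Apply the η law to `(a, δb; δ'c₁, d)` at `δz`, where `N = δδ'`. The symbol loses δ' because `d ≡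
1 (mod N)`, and `δ² ≡ δ'² ≡ 1 (mod 24)` makes the exponent affine in δ. -/
lemma eta_mul_smul_of_odd (hN : N.Coprime 6) {a b d : ℤ} {c₁ : ℕ} (hc : Odd c₁)
    (h : a * d - b * (N * c₁ : ℕ) = 1) (hd : (N : ℤ) ∣ d - 1) {δ : ℕ} (hδ : δ ∣ N) {z : ℂ}
    (hz : 0 < z.im) :
    eta (δ * ((a * z + b) / ((N * c₁ : ℕ) * z + d))) =
      jacobiSym d c₁ *
        (zeta24 ^ (3 : ℤ) * (zeta24 ^ ((a + d) * N * c₁ - b * d * (c₁ ^ 2 - 1) - 3 * N * c₁)) ^ δ) *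
        sqrt (-I * ((N * c₁ : ℕ) * z + d)) * eta (δ * z) := by
  obtain ⟨δ', rfl⟩ := hδ
  have hδ6 : δ.Coprime 6 := hN.coprime_dvd_left ⟨δ', rfl⟩
  have hδ6' : δ'.Coprime 6 := hN.coprime_dvd_left ⟨δ, mul_comm _ _⟩
  have hδ0 : 0 < δ := Nat.pos_of_ne_zero (by rintro rfl; simp at hδ6)
  have hδ0' : 0 < δ' := Nat.pos_of_ne_zero (by rintro rfl; simp at hδ6')
  have hδo : Odd δ' := Nat.coprime_two_right.mp (hδ6'.coprime_dvd_right (by norm_num))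
  have key := eta_smul_of_odd (δ' * c₁) (hδo.mul hc) a (δ * b) d
    (by push_cast at h ⊢; linear_combination h) (δ * z) (by simpa using mul_pos (Nat.cast_pos.mpr hδ0) hz)
  have e1 : (((δ' * c₁ : ℕ) : ℂ) * (δ * z) + d) = ((δ * δ' * c₁ : ℕ) * z + d) := by
    push_cast; ring
  have e2 : (a * (δ * z) + (δ * b : ℤ) : ℂ) = δ * (a * z + b) := by push_cast; ring
  have hJ : jacobiSym d (δ' * c₁) = jacobiSym d c₁ := by
    rw [jacobiSym.mul_right' _ hδ0'.ne' hc.pos.ne', jacobiSym.mod_left' (a₂ := 1),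
      jacobiSym.one_left, one_mul]
    exact ((Int.modEq_iff_dvd.mpr (dvd_trans ⟨δ, by push_cast; ring⟩ hd)).symm)
  rw [e1, e2, mul_div_assoc, hJ] at key
  rw [key]
  congr 3
  rw [← zpow_natCast, ← zpow_mul, ← zpow_add₀ zeta24_ne_zero]
  apply zeta24_zpow_eq_of_dvd
  obtain ⟨s, hs⟩ := dvd_sq_sub_one_of_coprime hδ6
  obtain ⟨t, ht⟩ := dvd_sq_sub_one_of_coprime hδ6'
  refine ⟨-(a + d) * c₁ * δ' * s - δ * b * d * c₁ ^ 2 * t + 3 * c₁ * δ' * s, ?_⟩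
  rw [etaExp]
  push_cast
  linear_combination (-(a + d) * c₁ * δ' + 3 * c₁ * δ') * hs - (δ * b * d * c₁ ^ 2) * ht

lemma prod_eta_mul_smul_of_odd (hN : N.Coprime 6) (hr : ∑ δ ∈ N.divisors, r δ = 2 * k)
    (hr' : (24 : ℤ) ∣ ∑ δ ∈ N.divisors, δ * r δ) {a b d : ℤ} {c₁ : ℕ} (hc : Odd c₁)
    (h : a * d - b * (N * c₁ : ℕ) = 1) (hd : (N : ℤ) ∣ d - 1) {z : ℂ} (hz : 0 < z.im) :
    ∏ δ ∈ N.divisors, eta (δ * ((a * z + b) / ((N * c₁ : ℕ) * z + d))) ^ r δ =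
      ((N * c₁ : ℕ) * z + d) ^ k * ∏ δ ∈ N.divisors, eta (δ * z) ^ r δ := by
  have hN0 : 0 < N := Nat.pos_of_ne_zero (by rintro rfl; simp at hN)
  rw [Finset.prod_congr rfl fun δ hδ => congrArg (· ^ r δ)
    (eta_mul_smul_of_odd hN hc h hd (Nat.dvd_of_mem_divisors hδ) hz)]
  have hW : ((N * c₁ : ℕ) * z + d : ℂ) ≠ 0 := by
    intro h0
    have := congrArg Complex.im h0
    simp [hN0.ne', hc.pos.ne', hz.ne'] at this
  generalize ((N * c₁ : ℕ) * z + d : ℂ) = W at *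
  have hcop : IsCoprime d (c₁ : ℤ) := ⟨a, -b * N, by push_cast at h; linear_combination h⟩
  have hJsq := jacobiSym.sq_one (Int.isCoprime_iff_gcd_eq_one.mp hcop)
  have hJ0 : (jacobiSym d c₁ : ℂ) ≠ 0 := by
    exact_mod_cast jacobiSym.ne_zero (Int.isCoprime_iff_gcd_eq_one.mp hcop)
  have hJ : (jacobiSym d c₁ : ℂ) ^ (2 * k) = 1 := by
    rw [zpow_mul, zpow_ofNat, ← Int.cast_pow, hJsq]
    simp
  have hs0 : sqrt (-I * W) ≠ 0 := by
    intro h0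
    have := sqrt_sq (-I * W)
    rw [h0] at this
    simp [hW] at this
  generalize (a + d) * N * c₁ - b * d * (c₁ ^ 2 - 1) - 3 * N * c₁ = E
  have hE : ∏ δ ∈ N.divisors, ((zeta24 ^ E) ^ δ) ^ r δ = 1 := by
    obtain ⟨t, ht⟩ := hr'
    simp_rw [← zpow_natCast, ← zpow_mul]
    rw [prod_zpow_eq_zpow_sum _ _ zeta24_ne_zero]
    simp_rw [mul_assoc]
    rw [← Finset.mul_sum, ht, mul_left_comm, zpow_mul, zeta24_pow_24, one_zpow]
  simp only [mul_zpow, Finset.prod_mul_distrib]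
  rw [prod_zpow_eq_zpow_sum _ _ hJ0, prod_zpow_eq_zpow_sum _ _ hs0, hE,
    prod_zpow_eq_zpow_sum _ _ (zpow_ne_zero _ zeta24_ne_zero), hr, hJ, sqrt_zpow_two_mul]
  -- The constant `(ζ³)^(2k) = I^k` cancels the `(-I)^k` from the roots.
  rw [mul_one, one_mul, ← sqrt_I_eq, sqrt_zpow_two_mul, ← mul_zpow, ← mul_assoc]
  simp

lemma etaQuotient_slash_of_odd (hN : N.Coprime 6) (hr : ∑ δ ∈ N.divisors, r δ = 2 * k)
    (hr' : (24 : ℤ) ∣ ∑ δ ∈ N.divisors, δ * r δ) {γ : SL(2, ℤ)}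
    (hγ : γ ∈ CongruenceSubgroup.Gamma1 N) (hpos : 0 < γ 1 0) (hodd : Odd (γ 1 0)) :
    etaQuotient N r ∣[k] γ = etaQuotient N r := by
  rw [CongruenceSubgroup.Gamma1_mem] at hγ
  obtain ⟨-, hd, hc⟩ := hγ
  have hdet := sl2_det γ
  have hd1 : (N : ℤ) ∣ γ 1 1 - 1 :=
    (ZMod.intCast_eq_intCast_iff_dvd_sub _ _ _).mp (by rw [Int.cast_one, hd])
  obtain ⟨c₁, hc₁⟩ : ∃ c₁ : ℕ, γ 1 0 = (N * c₁ : ℕ) := by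
    obtain ⟨t, ht⟩ := (ZMod.intCast_zmod_eq_zero_iff_dvd _ _).mp hc
    refine ⟨t.toNat, ?_⟩
    have : 0 < t := by
      by_contra! h0
      nlinarith
    rw [ht]; push_cast; rw [Int.toNat_of_nonneg this.le]
  have hodd₁ : Odd c₁ := by
    rw [hc₁] at hodd
    exact (Nat.odd_mul.mp (mod_cast hodd)).2
  ext τ
  have hden := sl2_denom_ne_zero γ τ
  have key := prod_eta_mul_smul_of_odd hN hr hr' hodd₁ (by rw [← hc₁]; exact hdet) hd1 τ.im_pos
  have hcast : ((γ 1 0 : ℤ) : ℂ) = ((N * c₁ : ℕ) : ℂ) := by rw [hc₁]; simp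
  rw [sl2_slash_apply, etaQuotient, coe_sl2_smul, hcast]
  rw [hcast] at hden
  erw [key]
  rw [mul_right_comm, ← zpow_add₀ hden, add_neg_cancel, zpow_zero, one_mul, etaQuotient]

/-- The lower triangular unipotent matrix `(1, 0; N, 1)`. -/
def lowerUnipotent (N : ℕ) : SL(2, ℤ) := ⟨!![1, 0; N, 1], by simp [Matrix.det_fin_two]⟩

lemma lowerUnipotent_mem (N : ℕ) : lowerUnipotent N ∈ CongruenceSubgroup.Gamma1 N := by
  rw [CongruenceSubgroup.Gamma1_mem]
  simp [lowerUnipotent]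

/-- An `η`-quotient of level `N` coprime to `6` with exponents satisfying the two linear
conditions is invariant under `Γ₁(N)`. -/
theorem etaQuotient_slash (hN : N.Coprime 6) (hr : ∑ δ ∈ N.divisors, r δ = 2 * k)
    (hr' : (24 : ℤ) ∣ ∑ δ ∈ N.divisors, δ * r δ) {γ : SL(2, ℤ)}
    (hγ : γ ∈ CongruenceSubgroup.Gamma1 N) :
    etaQuotient N r ∣[k] γ = etaQuotient N r := by
  have hNodd : Odd N := Nat.coprime_two_right.mp (hN.coprime_dvd_right (by norm_num))
  have of_odd : ∀ γ ∈ CongruenceSubgroup.Gamma1 N, Odd (γ 1 0) →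
      etaQuotient N r ∣[k] γ = etaQuotient N r := by
    intro γ hγ hodd
    rcases lt_or_ge 0 (γ 1 0) with h | h
    · exact etaQuotient_slash_of_odd hN hr hr' hγ h hodd
    · have hne : γ 1 0 ≠ 0 := by rintro h0; simp [h0] at hodd
      have h10 : γ⁻¹ 1 0 = -γ 1 0 := by
        simp [Matrix.SpecialLinearGroup.SL2_inv_expl]
      -- The inverse flips the sign of `c` while staying in Γ₁(N), which `-γ` need not do.
      have := etaQuotient_slash_of_odd hN hr hr' (inv_mem hγ)
        (by rw [h10]; lia) (by rw [h10]; exact hodd.neg)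
      rw [← this, ← SlashAction.slash_mul, inv_mul_cancel, SlashAction.slash_one, this]
  have hL : etaQuotient N r ∣[k] lowerUnipotent N = etaQuotient N r :=
    of_odd _ (lowerUnipotent_mem N) (by simpa [lowerUnipotent] using hNodd)
  by_cases hodd : Odd (γ 1 0)
  · exact of_odd γ hγ hodd
  · have hd : Odd (γ 1 1) := by
      have hdet := sl2_det γ
      by_contra hd
      rw [Int.not_odd_iff_even] at hd hodd
      have : Even (1 : ℤ) := hdet ▸ (hd.mul_left _).sub (hodd.mul_left _)
      simp at this
    have hmul : etaQuotient N r ∣[k] (γ * lowerUnipotent N) = etaQuotient N r := by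
      refine of_odd _ (mul_mem hγ (lowerUnipotent_mem N)) ?_
      have : (γ * lowerUnipotent N) 1 0 = γ 1 0 + γ 1 1 * N := by
        rw [Matrix.SpecialLinearGroup.coe_mul, Matrix.mul_apply, Fin.sum_univ_two]
        simp [lowerUnipotent]
      rw [this]
      exact (Int.not_odd_iff_even.mp hodd).add_odd (hd.mul (mod_cast hNodd))
    rw [SlashAction.slash_mul] at hmul
    have := congrArg (· ∣[k] (lowerUnipotent N)⁻¹) (hmul.trans hL.symm)
    simpa only [← SlashAction.slash_mul, mul_inv_cancel, SlashAction.slash_one, mul_assoc, mul_one]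
      using this

end Invariance

/-! ### Expansions at the cusps -/

open Function.Periodic (qParam)

/-- Euler's product `∏ (1 - x ^ n)`. -/
noncomputable def eulerProd (x : ℂ) : ℂ := ∏' n : ℕ, (1 - x ^ (n + 1))

lemma eulerProd_ne_zero {x : ℂ} (hx : x ∈ Metric.ball (0 : ℂ) 1) : eulerProd x ≠ 0 := by
  have hx1 : ‖x‖ < 1 := by simpa using hx
  rw [eulerProd]
  simp_rw [sub_eq_add_neg]
  refine tprod_one_add_ne_zero_of_summable (f := fun n => -x ^ (n + 1)) (fun n h0 => ?_) ?_
  · have h1 : x ^ (n + 1) = 1 := by linear_combination -h0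
    have h2 := pow_lt_one₀ (norm_nonneg x) hx1 n.succ_ne_zero
    rw [← norm_pow, h1] at h2
    simp at h2
  · simpa using (summable_nat_add_iff 1).mpr (summable_geometric_of_lt_one (norm_nonneg x) hx1)

/-- Width `24 * N` makes every exponent integral, so one local parameter serves all divisors δ. -/
lemma eta_div_eq {N A D M : ℕ} (hN : N = D * M) (hN0 : 0 < N) (B : ℤ) (z : ℂ) :
    eta ((A * z + B) / D) = exp (2 * Real.pi * I * (B / (24 * D))) *
      qParam (24 * N : ℕ) z ^ (A * M) *
      eulerProd (exp ((2 * Real.pi * B / D : ℝ) * I) * qParam (24 * N : ℕ) z ^ (24 * (A * M))) := by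
  subst hN
  have hD : (D : ℂ) ≠ 0 := by rintro h; simp_all
  have hM : (M : ℂ) ≠ 0 := by rintro h; simp_all
  have h1 : qParam 24 ((A * z + B) / D) =
      exp (2 * Real.pi * I * (B / (24 * D))) * qParam (24 * (D * M) : ℕ) z ^ (A * M) := by
    rw [qParam, qParam, ← exp_nat_mul, ← exp_add]
    congr 1
    push_cast
    field_simp
    ring
  have h2 : qParam 1 ((A * z + B) / D) =
      exp ((2 * Real.pi * B / D : ℝ) * I) * qParam (24 * (D * M) : ℕ) z ^ (24 * (A * M)) := by
    rw [qParam, qParam, ← exp_nat_mul, ← exp_add]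
    congr 1
    push_cast
    field_simp
    ring
  simp only [eta, eta_q, h1, h2, eulerProd]

/-- The behaviour of `η (δ z)` under an integral matrix with odd positive lower left entry. -/
lemma eta_mul_smul_eq {a b d : ℤ} {c : ℕ} (hc : Odd c) (h : a * d - b * c = 1) {δ : ℕ}
    (hδ : 0 < δ) :
    ∃ (C : ℂ) (A D : ℕ) (B : ℤ), 0 < A ∧ D ∣ δ ∧ ∀ z : ℂ, 0 < z.im →
      eta (δ * ((a * z + b) / (c * z + d))) =
        C * sqrt (-I * (c * z + d)) * eta ((A * z + B) / D) := by
  obtain ⟨D, hD⟩ := Nat.gcd_dvd_left δ c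
  obtain ⟨e, he⟩ := Nat.gcd_dvd_right δ c
  have hA : 0 < δ.gcd c := Nat.gcd_pos_of_pos_left _ hδ
  have hcop : D.Coprime e := by
    have := Nat.gcd_mul_left (δ.gcd c) D e
    rw [← hD, ← he] at this
    exact Nat.eq_of_mul_eq_mul_left hA (by rw [mul_one]; exact this.symm)
  generalize δ.gcd c = A at *
  subst he
  subst hD
  have hD0 : 0 < D := Nat.pos_of_mul_pos_left hδ
  have he : Odd e := (Nat.odd_mul.mp hc).2
  have hcop1 : IsCoprime (D * a) (e : ℤ) := by
    refine IsCoprime.mul_left (Nat.isCoprime_iff_coprime.mpr hcop) ⟨d, -b * A, ?_⟩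
    push_cast at h
    linear_combination h
  obtain ⟨y, x, hxy⟩ := hcop1
  push_cast at h
  -- Here `A = gcd(δ, c)`, `e = c / A` is odd and `γ' = (Da, -x; e, y)`. Its automorphy factor at
  -- `(Az + B)/D` is `(cz + d)/D`, whence `sqrt (1 / D)`.
  refine ⟨jacobiSym y e * zeta24 ^ etaExp (D * a) (-x) e y * sqrt (1 / D), A, D,
    y * (A * D) * b + x * d, Nat.pos_of_mul_pos_right hδ, ⟨A, by ring⟩, fun z hz => ?_⟩
  have hDC : (D : ℂ) ≠ 0 := by exact_mod_cast hD0.ne'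
  have hw : 0 < ((A * z + (y * (A * D) * b + x * d : ℤ)) / D : ℂ).im := by
    have e0 : ((A * z + (y * (A * D) * b + x * d : ℤ)) / D : ℂ) =
        ((A / D : ℝ) : ℂ) * z + (((y * (A * D) * b + x * d : ℤ) / D : ℝ) : ℂ) := by
      push_cast
      field_simp
    have hA' : (0 : ℝ) < A := by exact_mod_cast hA
    have hD' : (0 : ℝ) < D := by exact_mod_cast hD0
    rw [e0, add_im, im_ofReal_mul, ofReal_im, add_zero]
    positivity
  have hC : (a * d - b * (A * e) : ℂ) = 1 := by exact_mod_cast h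
  have hxyC : (y * (D * a) + x * e : ℂ) = 1 := by exact_mod_cast hxy
  have key := eta_smul_of_odd e he (D * a) (-x) y (by linear_combination hxy) _ hw
  have hden : (e * ((A * z + (y * (A * D) * b + x * d : ℤ)) / D) + y : ℂ) =
      ((A * e : ℕ) * z + d) * (1 / D) := by
    push_cast
    field_simp
    linear_combination d * hxyC - y * D * hC
  have hnum : ((D * a : ℤ) * ((A * z + (y * (A * D) * b + x * d : ℤ)) / D) + (-x : ℤ) : ℂ) =
      (A * D : ℕ) * (a * z + b) * (1 / D) := by
    push_cast
    field_simp
    linear_combination b * A * hxyC + x * hC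
  have hre : 0 < (-I * ((A * e : ℕ) * z + d)).re := by
    simpa using mul_pos (mul_pos (Nat.cast_pos.mpr hA) (Nat.cast_pos.mpr he.pos)) hz
  have hre' : 0 < (1 / D : ℂ).re := by
    rw [show (1 / D : ℂ) = ((1 / D : ℝ) : ℂ) by push_cast; rfl, ofReal_re]
    have hD' : (0 : ℝ) < D := by exact_mod_cast hD0
    positivity
  rw [hden, hnum, mul_div_mul_right _ _ (one_div_ne_zero hDC), mul_div_assoc, ← mul_assoc (-I),
    sqrt_mul_of_re_pos hre hre'] at key
  rw [key]
  ring

lemma eta_mul_smul_eq_qParam {N : ℕ} (hN : 0 < N) {a b d : ℤ} {c : ℕ} (hc : Odd c)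
    (h : a * d - b * c = 1) {δ : ℕ} (hδ : δ ∣ N) :
    ∃ (C : ℂ) (m : ℕ) (G : ℂ → ℂ), DifferentiableOn ℂ G (Metric.ball 0 1) ∧
      (∀ x ∈ Metric.ball (0 : ℂ) 1, G x ≠ 0) ∧ ∀ z : ℂ, 0 < z.im →
      eta (δ * ((a * z + b) / (c * z + d))) =
        C * sqrt (-I * (c * z + d)) * qParam (24 * N : ℕ) z ^ m * G (qParam (24 * N : ℕ) z) := by
  obtain ⟨C, A, D, B, hA, hD, key⟩ := eta_mul_smul_eq hc h (Nat.pos_of_dvd_of_pos hδ hN)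
  obtain ⟨M, hM⟩ := hD.trans hδ
  have hM0 : 0 < M := Nat.pos_of_ne_zero (by rintro rfl; simp_all)
  have hmem : ∀ x ∈ Metric.ball (0 : ℂ) 1,
      exp ((2 * Real.pi * B / D : ℝ) * I) * x ^ (24 * (A * M)) ∈ Metric.ball (0 : ℂ) 1 := by
    intro x hx
    rw [mem_ball_zero_iff] at hx ⊢
    rw [norm_mul, norm_exp_ofReal_mul_I, one_mul, norm_pow]
    exact pow_lt_one₀ (norm_nonneg x) hx (by positivity)
  refine ⟨C * exp (2 * Real.pi * I * (B / (24 * D))), A * M,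
    fun x => eulerProd (exp ((2 * Real.pi * B / D : ℝ) * I) * x ^ (24 * (A * M))),
    ?_, fun x hx => eulerProd_ne_zero (hmem x hx), fun z hz => ?_⟩
  · exact differentiableOn_tprod_one_sub_pow.comp (by fun_prop) hmem
  · rw [key z hz, eta_div_eq hM hN]
    ring

/-- The Taylor series of `F` at 0 converges on the whole disc, hence the expansion holds on all of
ℍ; `m` only shifts its indices. -/
lemma meromorphicAtImInfty_of_eq {h : ℕ} (hh : 0 < h) (m : ℤ) {F : ℂ → ℂ}
    (hF : DifferentiableOn ℂ F (Metric.ball 0 1)) {g : ℍ → ℂ}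
    (hg : ∀ τ : ℍ, g τ = qParam h τ ^ m * F (qParam h τ)) : MeromorphicAtImInfty g := by
  refine ⟨h, hh, m, fun n => if m ≤ n then
    ((n - m).toNat.factorial : ℂ)⁻¹ * iteratedDeriv (n - m).toNat F 0 else 0, ?_, fun τ => ?_⟩
  · intro n hn
    simp [not_le.mpr hn]
  · have hq : qParam h τ ∈ Metric.ball (0 : ℂ) 1 := by
      rw [mem_ball_zero_iff]
      exact Function.Periodic.norm_qParam_lt_one (mod_cast hh) τ.im_pos
    have hq0 : qParam h (τ : ℂ) ≠ 0 := Function.Periodic.qParam_ne_zero _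
    have hs := (hasSum_taylorSeries_on_ball hF hq).mul_left (qParam h τ ^ m)
    rw [← hg] at hs
    have hinj : Function.Injective (fun n : ℕ => (n : ℤ) + m) := fun x y hxy => by
      simpa using hxy
    rw [← hinj.hasSum_iff]
    · refine (congrArg (HasSum · (g τ)) (funext fun n => ?_)).mp hs
      simp only [Function.comp_apply, le_add_iff_nonneg_left, Nat.cast_nonneg, if_true,
        add_sub_cancel_right, Int.toNat_natCast, zpow_add₀ hq0, zpow_natCast, sub_zero, smul_eq_mul]
      ring
    · intro n hn
      have : ¬ m ≤ n := fun hmn => hn ⟨(n - m).toNat, by simp; lia⟩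
      simp [this]

lemma MeromorphicAtImInfty.const_mul {g : ℍ → ℂ} (hg : MeromorphicAtImInfty g) (C : ℂ) :
    MeromorphicAtImInfty fun τ => C * g τ := by
  obtain ⟨h, hh, m, a, ha, hs⟩ := hg
  refine ⟨h, hh, m, fun n => C * a n, fun n hn => by simp [ha n hn], fun τ => ?_⟩
  simpa only [mul_assoc] using (hs τ).mul_left C

variable {N : ℕ} {r : ℕ → ℤ} {k : ℤ}

lemma meromorphicAtImInfty_slash_of_odd (hN : 0 < N)
    (hr : ∑ δ ∈ N.divisors, r δ = 2 * k) {γ : SL(2, ℤ)} (hpos : 0 < γ 1 0) (hodd : Odd (γ 1 0)) :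
    MeromorphicAtImInfty (etaQuotient N r ∣[k] γ) := by
  obtain ⟨c, hc⟩ : ∃ c : ℕ, γ 1 0 = c := ⟨(γ 1 0).toNat, by lia⟩
  have hdet := sl2_det γ
  rw [hc] at hodd hdet
  have hex := fun δ (hδ : δ ∈ N.divisors) =>
    eta_mul_smul_eq_qParam hN (mod_cast hodd) hdet (Nat.dvd_of_mem_divisors hδ)
  choose! C m G hG hG0 key using hex
  refine meromorphicAtImInfty_of_eq (h := 24 * N) (by positivity)
    (∑ δ ∈ N.divisors, m δ * r δ)
    (F := fun x => (∏ δ ∈ N.divisors, C δ ^ r δ) * (-I) ^ k * ∏ δ ∈ N.divisors, G δ x ^ r δ)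
    ?_ fun τ => ?_
  · exact (DifferentiableOn.fun_finsetProd fun δ hδ =>
      (hG δ hδ).zpow (.inl (hG0 δ hδ))).const_mul _
  · have hden := sl2_denom_ne_zero γ τ
    have hcast : ((γ 1 0 : ℤ) : ℂ) = (c : ℂ) := by rw [hc]; simp
    rw [sl2_slash_apply, etaQuotient, coe_sl2_smul, hcast]
    rw [hcast] at hden
    have hs0 : sqrt (-I * (c * (τ : ℂ) + γ 1 1)) ≠ 0 := by
      intro h0
      have := sqrt_sq (-I * (c * (τ : ℂ) + γ 1 1))
      rw [h0] at this
      simp [hden] at this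
    have e := Finset.prod_congr rfl fun δ hδ => congrArg (· ^ r δ) (key δ hδ τ τ.im_pos)
    simp only [mul_zpow, Finset.prod_mul_distrib] at e
    simp_rw [← zpow_natCast, ← zpow_mul] at e
    rw [prod_zpow_eq_zpow_sum _ _ hs0, hr, sqrt_zpow_two_mul, mul_zpow,
      prod_zpow_eq_zpow_sum _ _ (Function.Periodic.qParam_ne_zero _)] at e
    erw [e]
    rw [zpow_neg]
    have := zpow_ne_zero k hden
    field_simp

/-- An `η`-quotient satisfying the hypotheses of `etaQuotient_slash` is meromorphic at the cusps. -/
theorem meromorphicAtImInfty_slash (hN : N.Coprime 6)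
    (hr : ∑ δ ∈ N.divisors, r δ = 2 * k) (hr' : (24 : ℤ) ∣ ∑ δ ∈ N.divisors, δ * r δ)
    (γ : SL(2, ℤ)) : MeromorphicAtImInfty (etaQuotient N r ∣[k] γ) := by
  have hN0 : 0 < N := Nat.pos_of_ne_zero (by rintro rfl; simp at hN)
  have hNodd : Odd N := Nat.coprime_two_right.mp (hN.coprime_dvd_right (by norm_num))
  have of_odd : ∀ γ : SL(2, ℤ), Odd (γ 1 0) →
      MeromorphicAtImInfty (etaQuotient N r ∣[k] γ) := by
    intro γ hodd
    rcases lt_or_ge 0 (γ 1 0) with h | h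
    · exact meromorphicAtImInfty_slash_of_odd hN0 hr h hodd
    · have hne : γ 1 0 ≠ 0 := by rintro h0; simp [h0] at hodd
      have h10 : (-γ) 1 0 = -γ 1 0 := by simp
      have h11 : (-γ) 1 1 = -γ 1 1 := by simp
      have := meromorphicAtImInfty_slash_of_odd (γ := -γ) hN0 hr
        (by rw [h10]; lia) (by rw [h10]; exact hodd.neg)
      -- `γ` and `-γ` act alike on ℍ, so the slashes differ by `(-1)^k`.
      convert MeromorphicAtImInfty.const_mul this ((-1) ^ k) using 1
      ext τ
      rw [sl2_slash_apply, sl2_slash_apply, ModularGroup.SL_neg_smul, h10, h11]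
      rw [show (((-γ 1 0 : ℤ) : ℂ) * τ + (-γ 1 1 : ℤ)) = (-1) * (γ 1 0 * τ + γ 1 1) by
        push_cast; ring, mul_zpow, mul_left_comm, ← mul_assoc ((-1 : ℂ) ^ k),
        ← zpow_add₀ (by norm_num)]
      simp
  by_cases hodd : Odd (γ 1 0)
  · exact of_odd γ hodd
  · have ha : Odd (γ 0 0) := by
      have hdet := sl2_det γ
      by_contra ha
      rw [Int.not_odd_iff_even] at ha hodd
      have : Even (1 : ℤ) := hdet ▸ (ha.mul_right _).sub (hodd.mul_left _)
      simp at this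
    -- Left multiplication by an element of Γ₁(N) leaves the slashed function unchanged and makes
    -- the lower left entry `N a + c` odd.
    have hmul := of_odd (lowerUnipotent N * γ) (by
      have : (lowerUnipotent N * γ) 1 0 = N * γ 0 0 + γ 1 0 := by
        rw [Matrix.SpecialLinearGroup.coe_mul, Matrix.mul_apply, Fin.sum_univ_two]
        simp [lowerUnipotent]
      rw [this]
      exact (Odd.mul (mod_cast hNodd) ha).add_even (Int.not_odd_iff_even.mp hodd))
    rwa [SlashAction.slash_mul, etaQuotient_slash hN hr hr' (lowerUnipotent_mem N)] at hmul

lemma mdifferentiable_etaQuotient (N : ℕ) (r : ℕ → ℤ) :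
    MDifferentiable 𝓘(ℂ) 𝓘(ℂ) (etaQuotient N r) := by
  rw [UpperHalfPlane.mdifferentiable_iff]
  have hmem : ∀ δ ∈ N.divisors, ∀ z : ℂ, 0 < z.im → 0 < ((δ : ℂ) * z).im := fun δ hδ z hz => by
    simpa using mul_pos (Nat.cast_pos.mpr (Nat.pos_of_mem_divisors hδ)) hz
  have : DifferentiableOn ℂ (fun z : ℂ => ∏ δ ∈ N.divisors, eta ((δ : ℂ) * z) ^ r δ)
      {z | 0 < z.im} := by
    refine DifferentiableOn.fun_finsetProd fun δ hδ => DifferentiableOn.zpow (fun z hz => ?_)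
      (.inl fun z hz => eta_ne_zero (hmem δ hδ z hz))
    exact ((differentiableAt_eta_of_mem_upperHalfPlaneSet (hmem δ hδ z hz)).comp z
      (by fun_prop)).differentiableWithinAt
  refine this.congr fun z hz => ?_
  simp [etaQuotient, UpperHalfPlane.ofComplex_apply_of_im_pos hz]

theorem etaQuotient_mem_weaklyModularForms (hN : N.Coprime 6)
    (hr : ∑ δ ∈ N.divisors, r δ = 2 * k) (hr' : (24 : ℤ) ∣ ∑ δ ∈ N.divisors, δ * r δ) :
    etaQuotient N r ∈ weaklyModularForms k (CongruenceSubgroup.Gamma1 N) where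
  holomorphic := mdifferentiable_etaQuotient N r
  slash_eq _ hγ := etaQuotient_slash hN hr hr' hγ
  meromorphic_at_cusps := meromorphicAtImInfty_slash hN hr hr'

/-! ### Choice of exponents for N = pq -/

lemma sum_divisors_mul_primes {p q : ℕ} (hp : p.Prime) (hq : q.Prime) (hpq : p ≠ q) (f : ℕ → ℤ) :
    ∑ δ ∈ (p * q).divisors, f δ = f 1 + f p + f q + f (p * q) := by
  have hdiv : (p * q).divisors = {1, p, q, p * q} := by
    ext d
    simp only [Nat.mem_divisors, Nat.dvd_mul, Nat.dvd_prime hp, Nat.dvd_prime hq,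
      Finset.mem_insert, Finset.mem_singleton]
    constructor
    · rintro ⟨⟨x, y, rfl | rfl, rfl | rfl, rfl⟩, -⟩ <;> simp
    · intro h
      refine ⟨?_, mul_ne_zero hp.ne_zero hq.ne_zero⟩
      rcases h with rfl | rfl | rfl | rfl
      · exact ⟨1, 1, by simp⟩
      · exact ⟨d, 1, by simp⟩
      · exact ⟨1, d, by simp⟩
      · exact ⟨p, q, by simp⟩
  have h1 := hp.one_lt
  have h2 := hq.one_lt
  have h3 : p < p * q := lt_mul_of_one_lt_right hp.pos h2
  have h4 : q < p * q := lt_mul_of_one_lt_left hq.pos h1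
  rw [hdiv, Finset.sum_insert, Finset.sum_insert, Finset.sum_insert, Finset.sum_singleton]
  · ring
  all_goals simp; lia

lemma exists_exponents {p q k : ℕ} (hp : p.Prime) (hq : q.Prime) (hp3 : 3 < p) (hq3 : 3 < q)
    (hpq : p ≠ q)
    (hdvd : Nat.gcd ((p - 1) / 2) (Nat.gcd ((q - 1) / 2) (Nat.gcd ((p * q - 1) / 2) 12)) ∣ k) :
    ∃ r : ℕ → ℤ, ∑ δ ∈ (p * q).divisors, r δ = 2 * k ∧
      (24 : ℤ) ∣ ∑ δ ∈ (p * q).divisors, δ * r δ := by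
  have hpo : Odd p := hp.odd_of_ne_two (by lia)
  have hqo : Odd q := hq.odd_of_ne_two (by lia)
  obtain ⟨s, hs⟩ := hpo.mul hqo
  obtain ⟨u, hu⟩ := hpo
  obtain ⟨v, hv⟩ := hqo
  rw [show (p - 1) / 2 = u by lia, show (q - 1) / 2 = v by lia,
    show (p * q - 1) / 2 = s by lia] at hdvd
  obtain ⟨t, ht⟩ := hdvd
  have h1 := Nat.gcd_eq_gcd_ab u (Nat.gcd v (Nat.gcd s 12))
  have h2 := Nat.gcd_eq_gcd_ab v (Nat.gcd s 12)
  have h3 := Nat.gcd_eq_gcd_ab s 12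
  obtain ⟨x, y, z, w, hk⟩ : ∃ x y z w : ℤ, (k : ℤ) = u * x + v * y + s * z + 12 * w := by
    rw [ht]
    push_cast
    rw [h1, h2, h3]
    exact ⟨u.gcdA (v.gcd (s.gcd 12)) * t, v.gcdA (s.gcd 12) * u.gcdB (v.gcd (s.gcd 12)) * t,
      s.gcdA 12 * v.gcdB (s.gcd 12) * u.gcdB (v.gcd (s.gcd 12)) * t,
      s.gcdB 12 * v.gcdB (s.gcd 12) * u.gcdB (v.gcd (s.gcd 12)) * t, by push_cast; ring⟩
  have hp1 : p ≠ 1 := by lia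
  have hq1 : q ≠ 1 := by lia
  have hpp : p * q ≠ p := by
    intro h0; exact hq1 (Nat.eq_of_mul_eq_mul_left hp.pos (by rw [h0, mul_one]))
  have hpq' : p * q ≠ q := by
    intro h0; exact hp1 (Nat.eq_of_mul_eq_mul_right hq.pos (by rw [h0, one_mul]))
  have hpq1 : p * q ≠ 1 := by
    intro h0; exact hp1 (Nat.eq_one_of_mul_eq_one_right h0)
  -- The exponent at 1 is forced by the weight; then `Σ δ r_δ = 2k - (p-1)x - (q-1)y - (pq-1)z =
  -- 24w`.
  refine ⟨fun δ => if δ = 1 then 2 * k + x + y + z else if δ = p then -x else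
    if δ = q then -y else -z, ?_, ?_⟩
  · rw [sum_divisors_mul_primes hp hq hpq]
    simp [hp1, hq1, hpp, hpq', hpq1, hpq.symm]
    ring
  · rw [sum_divisors_mul_primes hp hq hpq]
    simp [hp1, hq1, hpp, hpq', hpq1, hpq.symm]
    refine ⟨w, ?_⟩
    have hs' : (p * q : ℤ) = 2 * s + 1 := by exact_mod_cast hs
    have hu' : (p : ℤ) = 2 * u + 1 := by exact_mod_cast hu
    have hv' : (q : ℤ) = 2 * v + 1 := by exact_mod_cast hv
    linear_combination 2 * hk - z * hs' - x * hu' - y * hv'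

end EtaQuotient

theorem mainTheorem7 (p q k : ℕ) (hp : p.Prime) (hq : q.Prime) (hp3 : 3 < p) (hq3 : 3 < q)
    (hpq : p ≠ q) (hk : 0 < k)
    (hdvd : Nat.gcd ((p - 1) / 2) (Nat.gcd ((q - 1) / 2) (Nat.gcd ((p * q - 1) / 2) 12)) ∣ k) :
    ∃ f ∈ weaklyModularForms (k : ℤ) (CongruenceSubgroup.Gamma1 (p * q)),
      IsEtaQuotient (p * q) f := by
  obtain ⟨r, hr, hr'⟩ := EtaQuotient.exists_exponents hp hq hp3 hq3 hpq hdvd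
  have coprime_six : ∀ {l : ℕ}, l.Prime → 3 < l → l.Coprime 6 := fun {l} hl hl3 =>
    Nat.Coprime.mul_right (k := l) (m := 2) (n := 3) ((Nat.coprime_primes hl Nat.prime_two).mpr (by lia))
      ((Nat.coprime_primes hl Nat.prime_three).mpr (by lia))
  exact ⟨_, EtaQuotient.etaQuotient_mem_weaklyModularForms
    ((coprime_six hp hp3).mul_left (coprime_six hq hq3)) hr hr', r, rfl⟩
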